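/- Let $\mathbb K=\mathbb R$ or $\mathbb C$, and let $V,H$ be separable Hilbert spaces over $\mathbb K$ with $V$ continuously and densely embedded in $H$ by an injection $j$. Let $V'$ be the antidual of $V$, and view $H\subset V'$ via $h\mapsto (v\mapsto (h\mid v)_H)$. Let $\mathfrak a,\mathfrak b:[0,T]\times V\times V\to\mathbb K$ be families of sesquilinear forms, measurable in $t$, such that for $\mathfrak c\in\{\mathfrak a,\mathfrak b\}$, all $t\in[0,T]$ and all $u,v\in V$, $$|\mathfrak c(t,u,v)|\le M\|u\|_V\|v\|_V,\qquad \operatorname{Re}\mathfrak c(t,u,u)+\omega\|u\|_H^2\ge\alpha\|u\|_V^2,$$ where $M\ge0$, $\omega\in\mathbb R$, $\alpha>0$. Let $\mathcal A(t),\mathcal B(t):V\to V'$ be the associated operators. Let $MR(V,V,V')=H^1(0,T;V)\cap H^2(0,T;V')$ with norm $$\|u\|_{MR}=\big(\|u\|_{L^2(0,T;V)}^2+\|\dot u\|_{L^2(0,T;V)}^2+\|\ddot u\|_{L^2(0,T;V')}^2\big)^{1/2}.$$ For all $\omega\in\mathbb R$, $\alpha>0$, $M\ge0$ there is $T_0>0$,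 depending only on $\omega,\alpha,M$, such that for every $0<T<T_0$ there is a constant $C>0$, depending only on $\omega,\alpha,M,T$, with the following property. For all $\mathbb K,V,H,j,\mathfrak a,\mathfrak b$ as above, all $u_0\in V$, $u_1\in H$, $f\in L^2(0,T;V')$, every solution $u\in MR(V,V,V')$ of $$\ddot u(t)+\mathcal B(t)\dot u(t)+\mathcal A(t)u(t)=f(t)\ \text{ for a.e. } t\in(0,T),\qquad u(0)=u_0,\quad \dot u(0)=u_1$$ satisfies $$\|u\|_{MR}\le C\big[\|u_0\|_V+\|u_1\|_H+\|f\|_{L^2(0,T;V')}\big].$$ Moreover, for the equivalent norm $\big(\|u\|_{H^1(0,T;V)}^2+\|u\|_{H^2(0,T;V')}^2\big)^{1/2}$, which contains also the lower order terms in $V'$, the same estimate holds with $C$ replaced by $C(1+\|j\|^2)$, where $\|j\|$ is the norm of the embedding $V\hookrightarrow H$. -/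

import Mathlib

open MeasureTheory Set Filter Topology

noncomputable section

/-- The antidual `V'`: bounded antilinear functionals with the operator norm
(the ordinary dual when `𝕜 = ℝ`). -/
abbrev Antidual (𝕜 V : Type*) [RCLike 𝕜] [NormedAddCommGroup V] [InnerProductSpace 𝕜 V] :=
  V →L⋆[𝕜] 𝕜

/-- Given the embedding `j : V → H`, the map `H → V'` sending `h` to `v ↦ (h | v)_H`, where
`( | )_H` is linear in its first argument. Mathlib's `inner` is linear in its second argument,
so `(h | v)_H` is `inner 𝕜 (j v) h`. -/
def toAntidual {𝕜 V H : Type*} [RCLike 𝕜] [NormedAddCommGroup V] [InnerProductSpace 𝕜 V]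
    [NormedAddCommGroup H] [InnerProductSpace 𝕜 H] (j : V →L[𝕜] H) (h : H) : Antidual 𝕜 V :=
  (innerSLFlip 𝕜 h).comp j

theorem toAntidual_apply {𝕜 V H : Type*} [RCLike 𝕜] [NormedAddCommGroup V]
    [InnerProductSpace 𝕜 V] [NormedAddCommGroup H] [InnerProductSpace 𝕜 H]
    (j : V →L[𝕜] H) (h : H) (v : V) : toAntidual j h v = inner 𝕜 (j v) h := rfl

/-- Lebesgue measure on the time interval `(0, T)`. -/
abbrev timeMeasure (T : ℝ) : Measure ℝ := volume.restrict (Ioo 0 T)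

/-- The norm of `L²(0,T;E)`. -/
def l2Norm {E : Type*} [NormedAddCommGroup E] (T : ℝ) (g : ℝ → E) : ℝ :=
  (eLpNorm g 2 (timeMeasure T)).toReal

/-- `dg` is the weak derivative of `g` on `(0, T)`. -/
def HasWeakDeriv {E : Type*} [NormedAddCommGroup E] [NormedSpace ℝ E] (T : ℝ) (g dg : ℝ → E) :
    Prop :=
  ∀ φ : ℝ → ℝ, ContDiff ℝ ((⊤ : ℕ∞) : WithTop ℕ∞) φ → HasCompactSupport φ → tsupport φ ⊆ Ioo 0 T →
    ∫ t in Ioo 0 T, deriv φ t • g t = -∫ t in Ioo 0 T, φ t • dg t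

/-- `g(0) = x`, for the continuous representative of `g` on `[0, T]`. -/
def HasInitialValue {E : Type*} [NormedAddCommGroup E] (T : ℝ) (g : ℝ → E) (x : E) : Prop :=
  ∃ c : ℝ → E, ContinuousOn c (Icc 0 T) ∧ c =ᵐ[timeMeasure T] g ∧ c 0 = x

section Forms

variable {𝕜 V H : Type*} [RCLike 𝕜] [NormedAddCommGroup V] [InnerProductSpace 𝕜 V]
  [NormedAddCommGroup H] [InnerProductSpace 𝕜 H]

/-- `a` is a `V`-bounded non-autonomous sesquilinear form on `[0, T]` with constant `M`.
A bounded sesquilinear form is the same as a bounded operator `V → V'`, so `a t` is at the same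
time the operator associated with the form `(u, v) ↦ a t u v`. Values of `a` outside `[0, T]`
play no role. -/
structure IsBoundedForm (T M : ℝ) (a : ℝ → V →L[𝕜] Antidual 𝕜 V) : Prop where
  measurable : ∀ u v : V, AEMeasurable (fun t => a t u v) (volume.restrict (Icc 0 T))
  bound : ∀ t ∈ Icc 0 T, ∀ u v : V, ‖a t u v‖ ≤ M * ‖u‖ * ‖v‖

/-- `a` is quasi-coercive on `[0, T]` with constants `ω` and `α`. -/
def IsQuasiCoercive (j : V →L[𝕜] H) (T ω α : ℝ) (a : ℝ → V →L[𝕜] Antidual 𝕜 V) : Prop :=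
  ∀ t ∈ Icc 0 T, ∀ u : V, α * ‖u‖ ^ 2 ≤ RCLike.re (a t u u) + ω * ‖j u‖ ^ 2

/-- `u` belongs to `MR(V,V,V') = H¹(0,T;V) ∩ H²(0,T;V')`, with first derivative `du` and second
derivative `ddu`. -/
structure IsMR [NormedSpace ℝ V] (j : V →L[𝕜] H) (T : ℝ) (u du : ℝ → V)
    (ddu : ℝ → Antidual 𝕜 V) : Prop where
  memLp_u : MemLp u 2 (timeMeasure T)
  memLp_du : MemLp du 2 (timeMeasure T)
  memLp_ddu : MemLp ddu 2 (timeMeasure T)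
  deriv_u : HasWeakDeriv T u du
  deriv_du : HasWeakDeriv T (fun t => toAntidual j (j (du t))) ddu

/-- The norm `(‖u‖²_{L²(V)} + ‖u̇‖²_{L²(V)} + ‖ü‖²_{L²(V')})^{1/2}` of `MR(V,V,V')`. -/
def mrNorm (T : ℝ) (u du : ℝ → V) (ddu : ℝ → Antidual 𝕜 V) : ℝ :=
  √(l2Norm T u ^ 2 + l2Norm T du ^ 2 + l2Norm T ddu ^ 2)

/-- The intersection norm `(‖u‖²_{H¹(0,T;V)} + ‖u‖²_{H²(0,T;V')})^{1/2}` of `MR(V,V,V')`. -/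
def mrFullNorm (j : V →L[𝕜] H) (T : ℝ) (u du : ℝ → V) (ddu : ℝ → Antidual 𝕜 V) : ℝ :=
  √((l2Norm T u ^ 2 + l2Norm T du ^ 2) +
    (l2Norm T (fun t => toAntidual j (j (u t))) ^ 2 +
      l2Norm T (fun t => toAntidual j (j (du t))) ^ 2 + l2Norm T ddu ^ 2))

/-- `u ∈ MR(V,V,V')`, with derivatives `du` and `ddu`, solves `ü + B(t) u̇ + A(t) u = f` a.e. on
`(0, T)` in `V'` with `u(0) = u₀` and `u̇(0) = u₁`. The initial velocity is read in `V'`, through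
the continuous representative of `u̇ ∈ H¹(0,T;V')` and the embedding of `H` into `V'`. -/
structure IsSolution [NormedSpace ℝ V] (j : V →L[𝕜] H) (T : ℝ) (a b : ℝ → V →L[𝕜] Antidual 𝕜 V)
    (f : ℝ → Antidual 𝕜 V) (u₀ : V) (u₁ : H) (u du : ℝ → V) (ddu : ℝ → Antidual 𝕜 V) :
    Prop where
  mr : IsMR j T u du ddu
  equation : ∀ᵐ t ∂timeMeasure T, ddu t + b t (du t) + a t (u t) = f t
  initial_value : HasInitialValue T u u₀
  initial_velocity : HasInitialValue T (fun t => toAntidual j (j (du t))) (toAntidual j u₁)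

end Forms

end

/-!
# A priori estimate for non-autonomous second order problems

The estimate comes from testing the equation with the velocity `w = u̇`, and no form is ever
differentiated in time: quasi-coercivity of `b` bounds `∫ ‖w‖²_V`, and
`‖u‖_{L²(0,T;V)} ≤ √T (‖u₀‖ + √T ‖w‖_{L²(0,T;V)})` turns `∫ a(u, w)` into a perturbation of
size `M T ∫ ‖w‖²_V`, which is absorbed when `M T ≤ α / 4`. The acceleration is then read off from
the equation. The norm of the embedding `j` enters none of these steps, only the comparison of the
two norms of the maximal regularity space.

The energy identity `d/dt ‖w‖²_H = 2 Re ⟨ẇ, w⟩` is needed only as an inequality, integrated against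
the weight `ρ(t) = 1 - 2 |ω| t`: see `weighted_energy_inequality`. The slope of `ρ` produces the
term `|ω| ∫ ‖w‖²_H`, which compensates the defect `ω ‖w‖²_H` of coercivity. The inequality follows
from the elementary bound `‖x‖² - ‖y‖² ≤ 2 Re (x | x - y)` applied to `w(t)` and `w(t - h)`. The
difference `w(t) - w(t - h)` is, in `V'`, the integral of `ẇ` over `[t - h, t]`, and Steklov averages
converge weakly in `L²` (`tendsto_integral_pairing_steklov`). Setting the past of `w`
equal to `u₁` makes the same bound account for the initial velocity, although the latter is attained
only in `V'`, so that continuity of `w` with values in `H` is not needed.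

That `u` and `u̇` are primitives of their weak derivatives, starting at the initial values, is
`HasWeakDeriv.ae_eq_initialValue_add_integral`.
-/

/-! ### Weak derivatives on an interval -/

/-- A test function on `(0, T)` with vanishing integral is the derivative of a test function. -/
theorem exists_testFunction_hasDerivAt {T : ℝ} (hT : 0 < T) {η : ℝ → ℝ}
    (hη : ContDiff ℝ ((⊤ : ℕ∞) : WithTop ℕ∞) η) (hc : HasCompactSupport η)
    (hs : tsupport η ⊆ Ioo 0 T) (h0 : ∫ t, η t = 0) :
    ∃ φ : ℝ → ℝ, ContDiff ℝ ((⊤ : ℕ∞) : WithTop ℕ∞) φ ∧ HasCompactSupport φ ∧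
      tsupport φ ⊆ Ioo 0 T ∧ ∀ t, HasDerivAt φ (η t) t := by
  have hd : ∀ t, HasDerivAt (fun x => ∫ s in (0 : ℝ)..x, η s) (η t) t := fun t =>
    (hη.continuous).integral_hasStrictDerivAt 0 t |>.hasDerivAt
  -- adding the midpoint makes the support nonempty, so that it has a least and a greatest element
  have hK : IsCompact (insert (T / 2) (tsupport η)) := IsCompact.insert hc _
  have hKne : (insert (T / 2) (tsupport η)).Nonempty := insert_nonempty _ _
  have hKT : insert (T / 2) (tsupport η) ⊆ Ioo 0 T :=
    insert_subset ⟨by linarith, by linarith⟩ hs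
  have ha := hK.isLeast_sInf hKne
  have hb := hK.isGreatest_sSup hKne
  set a := sInf (insert (T / 2) (tsupport η))
  set b := sSup (insert (T / 2) (tsupport η))
  have ha0 : 0 < a := (hKT ha.1).1
  have hbT : b < T := (hKT hb.1).2
  have hηa : ∀ t < a, η t = 0 := fun t ht => by
    by_contra h
    exact absurd (ha.2 (mem_insert_of_mem _ (subset_tsupport _ h))) (not_le.2 ht)
  have hηb : ∀ t, b < t → η t = 0 := fun t ht => by
    by_contra h
    exact absurd (hb.2 (mem_insert_of_mem _ (subset_tsupport _ h))) (not_le.2 ht)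
  have hsub : tsupport (fun x => ∫ s in (0 : ℝ)..x, η s) ⊆ Icc a b := by
    refine closure_minimal (fun x hx => ?_) isClosed_Icc
    by_contra hx'
    apply hx
    rcases lt_or_ge x a with h | h
    · refine intervalIntegral.integral_zero_ae (Eventually.of_forall fun s hs => hηa s ?_)
      exact lt_of_le_of_lt hs.2 (max_lt ha0 h)
    · have hbx : b < x := not_le.1 fun h' => hx' ⟨h, h'⟩
      have h0x : 0 ≤ x := ha0.le.trans h
      change ∫ s in (0 : ℝ)..x, η s = 0
      rw [intervalIntegral.integral_of_le h0x, setIntegral_eq_integral_of_forall_compl_eq_zero, h0]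
      intro s hs
      rcases le_or_gt s 0 with h1 | h1
      · exact hηa s (h1.trans_lt ha0)
      · exact hηb s (hbx.trans (not_le.1 fun h' => hs ⟨h1, h'⟩))
  refine ⟨fun x => ∫ s in (0 : ℝ)..x, η s, ?_, ?_, ?_, hd⟩
  · refine contDiff_infty_iff_deriv.2 ⟨fun t => (hd t).differentiableAt, ?_⟩
    rwa [show deriv (fun x => ∫ s in (0 : ℝ)..x, η s) = η from funext fun t => (hd t).deriv]
  · exact HasCompactSupport.of_support_subset_isCompact isCompact_Icc
      ((subset_tsupport _).trans hsub)
  · exact hsub.trans (Icc_subset_Ioo ha0 hbT)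

section WeakDeriv

variable {E : Type*} [NormedAddCommGroup E] [NormedSpace ℝ E] [CompleteSpace E]

/-- Integration by parts of a test function against a primitive of an integrable function. -/
theorem integral_deriv_smul_primitive {T : ℝ} {φ η : ℝ → ℝ} {g : ℝ → E}
    (hφ : ∀ t, HasDerivAt φ (η t) t) (hη : Continuous η) (hφT : φ T = 0)
    (hg : IntegrableOn g (Ioo 0 T)) :
    ∫ t in Ioo 0 T, η t • ∫ s in (0 : ℝ)..t, g s = -∫ t in Ioo 0 T, φ t • g t := by
  have hηi : IntegrableOn η (Ioo 0 T) :=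
    (hη.integrableOn_Icc (a := 0) (b := T)).mono_set Ioo_subset_Icc_self
  have hint : Integrable (fun p : ℝ × ℝ => {q : ℝ × ℝ | q.2 ≤ q.1}.indicator
      (fun q => η q.1 • g q.2) p) ((timeMeasure T).prod (timeMeasure T)) :=
    (hηi.smul_prod hg).indicator (measurableSet_le measurable_snd measurable_fst)
  have h1 : ∀ t ∈ Ioo 0 T, η t • ∫ s in (0 : ℝ)..t, g s =
      ∫ s in Ioo 0 T, {q : ℝ × ℝ | q.2 ≤ q.1}.indicator (fun q => η q.1 • g q.2) (t, s) := by
    intro t ht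
    have : ∀ s, {q : ℝ × ℝ | q.2 ≤ q.1}.indicator (fun q => η q.1 • g q.2) (t, s) =
        (Iic t).indicator (fun s => η t • g s) s := fun s => by
      simp [indicator_apply]
    simp_rw [this]
    rw [setIntegral_indicator measurableSet_Iic, integral_smul,
      intervalIntegral.integral_of_le ht.1.le]
    have h3 : Ioc 0 t = Ioo 0 T ∩ Iic t := by
      ext s
      simp only [mem_inter_iff, mem_Ioc, mem_Ioo, mem_Iic]
      exact ⟨fun h => ⟨⟨h.1, h.2.trans_lt ht.2⟩, h.2⟩, fun h => ⟨h.1.1, h.2⟩⟩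
    rw [h3]
  have h2 : ∀ s ∈ Ioo 0 T, ∫ t in Ioo 0 T,
      {q : ℝ × ℝ | q.2 ≤ q.1}.indicator (fun q => η q.1 • g q.2) (t, s) = -(φ s • g s) := by
    intro s hs
    have : ∀ t, {q : ℝ × ℝ | q.2 ≤ q.1}.indicator (fun q => η q.1 • g q.2) (t, s) =
        (Ici s).indicator η t • g s := fun t => by
      by_cases h : s ≤ t <;> simp [h]
    simp_rw [this]
    rw [integral_smul_const, setIntegral_indicator measurableSet_Ici]
    have h3 : Ioo 0 T ∩ Ici s = Ico s T := by
      ext t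
      simp only [mem_inter_iff, mem_Ioo, mem_Ici, mem_Ico]
      exact ⟨fun h => ⟨h.2, h.1.2⟩, fun h => ⟨⟨hs.1.trans_le h.1, h.2⟩, h.1⟩⟩
    rw [h3, integral_Ico_eq_integral_Ioc, ← intervalIntegral.integral_of_le hs.2.le,
      intervalIntegral.integral_eq_sub_of_hasDerivAt (fun t _ => hφ t)
        (hη.intervalIntegrable _ _), hφT, zero_sub, neg_smul]
  rw [setIntegral_congr_fun measurableSet_Ioo h1, integral_integral_swap hint,
    setIntegral_congr_fun measurableSet_Ioo h2, integral_neg]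

/-- A function with an integrable weak derivative is, up to a constant, the primitive of that
derivative (the lemma of du Bois-Reymond). -/
theorem HasWeakDeriv.exists_ae_eq_add_integral {T : ℝ} (hT : 0 < T) {g dg : ℝ → E}
    (hg : IntegrableOn g (Ioo 0 T)) (hdg : IntegrableOn dg (Ioo 0 T)) (h : HasWeakDeriv T g dg) :
    ∃ c : E, ∀ᵐ t ∂timeMeasure T, g t = c + ∫ s in (0 : ℝ)..t, dg s := by
  have hdgI : IntervalIntegrable dg volume 0 T := by
    rwa [intervalIntegrable_iff_integrableOn_Ioo_of_le hT.le]
  have hGc : ContinuousOn (fun t => ∫ s in (0 : ℝ)..t, dg s) (Icc 0 T) := by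
    have := intervalIntegral.continuousOn_primitive_interval' hdgI left_mem_uIcc
    rwa [uIcc_of_le hT.le] at this
  set F : ℝ → E := fun t => g t - ∫ s in (0 : ℝ)..t, dg s with hF
  have hGi : IntegrableOn (fun t => ∫ s in (0 : ℝ)..t, dg s) (Ioo 0 T) :=
    (hGc.integrableOn_Icc).mono_set Ioo_subset_Icc_self
  have hFi : IntegrableOn F (Ioo 0 T) := hg.sub hGi
  -- a test function that fixes the constant
  obtain ⟨θ₀, hθs, hθc, hθd, hθr, hθ1⟩ := exists_contDiff_tsupport_subset (n := (⊤ : ℕ∞))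
    (s := Ioo 0 T) (x := T / 2) (Ioo_mem_nhds (by linarith) (by linarith))
  have hθpos : 0 < ∫ t, θ₀ t := by
    refine hθd.continuous.integral_pos_of_hasCompactSupport_nonneg_nonzero hθc
      (fun x => (hθr (mem_range_self x)).1) (x := T / 2) (by rw [hθ1]; exact one_ne_zero)
  set I := ∫ t, θ₀ t
  -- bounded continuous multiples stay integrable
  have hmul : ∀ {η : ℝ → ℝ} {K : ℝ → E}, Continuous η → HasCompactSupport η →
      IntegrableOn K (Ioo 0 T) → IntegrableOn (fun t => η t • K t) (Ioo 0 T) := by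
    intro η K hη hc hK
    obtain ⟨C, hC⟩ := hη.bounded_above_of_compact_support hc
    exact hK.bdd_smul C hη.aestronglyMeasurable (Eventually.of_forall hC)
  -- `F` is orthogonal to derivatives of test functions
  have key : ∀ η : ℝ → ℝ, ContDiff ℝ ((⊤ : ℕ∞) : WithTop ℕ∞) η → HasCompactSupport η →
      tsupport η ⊆ Ioo 0 T → ∫ t, η t = 0 → ∫ t in Ioo 0 T, η t • F t = 0 := by
    intro η hη hc hs h0
    obtain ⟨φ, hφ, hφc, hφs, hφd⟩ := exists_testFunction_hasDerivAt hT hη hc hs h0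
    have e : deriv φ = η := funext fun t => (hφd t).deriv
    have hφT : φ T = 0 := by
      by_contra hne
      exact lt_irrefl T (hφs (subset_tsupport _ hne)).2
    have h1 := h φ hφ hφc hφs
    rw [e] at h1
    simp only [hF, smul_sub]
    rw [integral_sub (hmul hη.continuous hc hg) (hmul hη.continuous hc hGi), h1,
      integral_deriv_smul_primitive hφd hη.continuous hφT hdg, sub_self]
  refine ⟨I⁻¹ • ∫ t in Ioo 0 T, θ₀ t • F t, ?_⟩
  set c := I⁻¹ • ∫ t in Ioo 0 T, θ₀ t • F t with hc
  have hci : IntegrableOn (fun _ : ℝ => c) (Ioo 0 T) := integrableOn_const (by simp)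
  have hz : ∀ᵐ t, t ∈ Ioo 0 T → F t - c = 0 := by
    refine isOpen_Ioo.ae_eq_zero_of_integral_contDiff_smul_eq_zero
      (hFi.sub hci).locallyIntegrableOn fun ψ hψ hψc hψs => ?_
    have hψ0 : ∀ t, t ∉ Ioo 0 T → ψ t • (F t - c) = 0 := fun t ht => by
      rw [image_eq_zero_of_notMem_tsupport fun h' => ht (hψs h'), zero_smul]
    rw [← setIntegral_eq_integral_of_forall_compl_eq_zero hψ0]
    have hψI : ∫ t in Ioo 0 T, ψ t = ∫ t, ψ t :=
      setIntegral_eq_integral_of_forall_compl_eq_zero fun t ht =>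
        image_eq_zero_of_notMem_tsupport fun h' => ht (hψs h')
    set m := ∫ t, ψ t
    have h1 := key (fun t => ψ t - (m / I) * θ₀ t) (hψ.sub (contDiff_const.mul hθd))
      (hψc.sub (hθc.mul_left)) ?_ ?_
    · simp only [sub_smul, mul_smul] at h1
      have hθF : IntegrableOn (fun t => (m / I) • θ₀ t • F t) (Ioo 0 T) :=
        (hmul hθd.continuous hθc hFi).smul (m / I)
      rw [integral_sub (hmul hψ.continuous hψc hFi) hθF, integral_smul, sub_eq_zero] at h1
      simp only [smul_sub]
      rw [integral_sub (hmul hψ.continuous hψc hFi) (hmul hψ.continuous hψc hci), h1,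
        integral_smul_const, hψI, hc, smul_smul, div_eq_mul_inv, sub_self]
    · refine (tsupport_sub _ _).trans (union_subset hψs ?_)
      exact (tsupport_mul_subset_right).trans hθs
    · rw [integral_sub (hψ.continuous.integrable_of_hasCompactSupport hψc)
        ((hθd.continuous.integrable_of_hasCompactSupport hθc).const_mul _), integral_const_mul,
        div_mul_cancel₀ _ hθpos.ne', sub_self]
  filter_upwards [(ae_restrict_iff' measurableSet_Ioo).2 hz] with t ht
  rw [sub_eq_zero] at ht
  rw [← ht, hF]
  simp

/-- Fundamental theorem of calculus for weak derivatives, with the initial value as constant. -/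
theorem HasWeakDeriv.ae_eq_initialValue_add_integral {T : ℝ} (hT : 0 < T) {g dg : ℝ → E} {x : E}
    (hg : IntegrableOn g (Ioo 0 T)) (hdg : IntegrableOn dg (Ioo 0 T)) (h : HasWeakDeriv T g dg)
    (hx : HasInitialValue T g x) :
    ∀ᵐ t ∂timeMeasure T, g t = x + ∫ s in (0 : ℝ)..t, dg s := by
  obtain ⟨c, hc⟩ := h.exists_ae_eq_add_integral hT hg hdg
  obtain ⟨γ, hγc, hγ, rfl⟩ := hx
  have hdgI : IntervalIntegrable dg volume 0 T := by
    rwa [intervalIntegrable_iff_integrableOn_Ioo_of_le hT.le]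
  have hGc : ContinuousOn (fun t => c + ∫ s in (0 : ℝ)..t, dg s) (Icc 0 T) := by
    have := intervalIntegral.continuousOn_primitive_interval' hdgI left_mem_uIcc
    rw [uIcc_of_le hT.le] at this
    exact continuousOn_const.add this
  have hae : γ =ᵐ[volume.restrict (Icc 0 T)] fun t => c + ∫ s in (0 : ℝ)..t, dg s := by
    rw [← restrict_Ioo_eq_restrict_Icc]
    filter_upwards [hc, hγ] with t h1 h2
    rw [h2, h1]
  have h0 := Measure.eqOn_Icc_of_ae_eq volume hT.ne hae hγc hGc (left_mem_Icc.2 hT.le)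
  simp only [intervalIntegral.integral_same, add_zero] at h0
  rwa [h0]

end WeakDeriv

/-! ### Steklov averages -/

section Steklov

variable {E F : Type*} [NormedAddCommGroup E] [NormedSpace ℝ E]
  [NormedAddCommGroup F] [NormedSpace ℝ F]

/-- The correlation `s ↦ ∫ B(G(t - s), p(t)) dt` of two square integrable functions is continuous,
because translations act continuously on `L²`. -/
theorem continuous_integral_translate_pairing (B : E →L[ℝ] F →L[ℝ] ℝ) {G : ℝ → E} {p : ℝ → F}
    (hG : MemLp G 2) (hp : MemLp p 2) : Continuous fun s => ∫ t, B (G (t - s)) (p t) := by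
  have hmp : ∀ s : ℝ, MeasurePreserving (fun t : ℝ => t - s) volume volume :=
    fun s => measurePreserving_sub_right volume s
  let τ : C(ℝ, C(ℝ, ℝ)) := ContinuousMap.curry ⟨fun q : ℝ × ℝ => q.2 - q.1, by fun_prop⟩
  have hτ : ∀ s, MeasurePreserving (τ s) volume volume := hmp
  have hc : Continuous fun s => Lp.compMeasurePreserving (τ s) (hτ s) (hG.toLp G) :=
    Continuous.compMeasurePreservingLp continuous_const τ.continuous hτ (by simp)
  have hI : ∀ s, B.lpPairing volume 2 2 (Lp.compMeasurePreserving (τ s) (hτ s) (hG.toLp G))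
      (hp.toLp p) = ∫ t, B (G (t - s)) (p t) := by
    intro s
    rw [ContinuousLinearMap.lpPairing_eq_integral]
    refine integral_congr_ae ?_
    filter_upwards [Lp.coeFn_compMeasurePreserving (hG.toLp G) (hτ s), hp.coeFn_toLp,
      (hmp s).quasiMeasurePreserving.ae_eq_comp hG.coeFn_toLp] with t h1 h2 h3
    rw [h1, h2]
    congr 2
  simp_rw [← hI]
  fun_prop

/-- The correlation integrand of two square integrable functions is integrable over a bounded range
of shifts. -/
theorem integrable_prod_translate_pairing (B : E →L[ℝ] F →L[ℝ] ℝ) {G : ℝ → E} {p : ℝ → F}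
    (hG : MemLp G 2) (hp : MemLp p 2) (h : ℝ) :
    Integrable (fun q : ℝ × ℝ => B (G (q.1 - q.2)) (p q.1))
      (volume.prod (volume.restrict (Ioc 0 h))) := by
  have hconst : Integrable (fun _ : ℝ => (1 : ℝ)) (volume.restrict (Ioc 0 h)) :=
    integrable_const _
  have hG2 : Integrable (fun t => ‖G t‖ ^ 2) := hG.integrable_norm_pow (by norm_num)
  have hp2 : Integrable (fun t => ‖p t‖ ^ 2) := hp.integrable_norm_pow (by norm_num)
  -- `‖B(x, y)‖ ≤ ‖B‖ (‖x‖² + ‖y‖²)` reduces integrability on the product to that of squares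
  have hb1 : Integrable (fun q : ℝ × ℝ => ‖G (q.1 - q.2)‖ ^ 2)
      (volume.prod (volume.restrict (Ioc 0 h))) := by
    simpa using hconst.convolution_integrand (ContinuousLinearMap.mul ℝ ℝ) hG2
  have hb2 : Integrable (fun q : ℝ × ℝ => ‖p q.1‖ ^ 2)
      (volume.prod (volume.restrict (Ioc 0 h))) := by
    simpa using hp2.mul_prod hconst
  have hm1 : AEStronglyMeasurable (fun q : ℝ × ℝ => G (q.1 - q.2))
      (volume.prod (volume.restrict (Ioc 0 h))) := by
    simpa using AEStronglyMeasurable.convolution_integrand (ContinuousLinearMap.lsmul ℝ ℝ)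
      hconst.aestronglyMeasurable hG.aestronglyMeasurable
  refine Integrable.mono' ((hb1.add hb2).const_mul ‖B‖)
    (B.aestronglyMeasurable_comp₂ hm1 hp.aestronglyMeasurable.comp_fst)
    (Eventually.of_forall fun q => ?_)
  refine (B.le_opNorm₂ _ _).trans ?_
  simp only [Pi.add_apply]
  rw [mul_assoc]
  refine mul_le_mul_of_nonneg_left ?_ (norm_nonneg B)
  nlinarith [sq_nonneg (‖G (q.1 - q.2)‖ - ‖p q.1‖), sq_nonneg ‖G (q.1 - q.2)‖, sq_nonneg ‖p q.1‖]

variable [CompleteSpace E]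

theorem pairing_increment_eq_integral (B : E →L[ℝ] F →L[ℝ] ℝ) {G : ℝ → E} (hG : MemLp G 2)
    {h : ℝ} (hh : 0 ≤ h) (t : ℝ) (x : F) :
    B (∫ r in (t - h)..t, G r) x = ∫ s in Ioc 0 h, B (G (t - s)) x := by
  have hGl : LocallyIntegrable G := hG.locallyIntegrable (by norm_num)
  have hi : IntervalIntegrable (fun s => G (t - s)) volume 0 h := by
    have hGi : IntervalIntegrable G volume t (t - h) :=
      (hGl.integrableOn_isCompact isCompact_uIcc).intervalIntegrable
    simpa using hGi.comp_sub_left t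
  have e : ∫ r in (t - h)..t, G r = ∫ s in (0 : ℝ)..h, G (t - s) := by
    rw [intervalIntegral.integral_comp_sub_left, sub_zero]
  rw [e, ← intervalIntegral.integral_of_le hh]
  exact ((B.flip x).intervalIntegral_comp_comm hi).symm

theorem integrable_pairing_increment (B : E →L[ℝ] F →L[ℝ] ℝ) {G : ℝ → E} {p : ℝ → F}
    (hG : MemLp G 2) (hp : MemLp p 2) {h : ℝ} (hh : 0 ≤ h) :
    Integrable fun t => B (∫ r in (t - h)..t, G r) (p t) := by
  simp_rw [pairing_increment_eq_integral B hG hh]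
  exact (integrable_prod_translate_pairing B hG hp h).integral_prod_left

/-- Fubini: pairing `p` with the increments over `[t - h, t]` of a primitive of `G` is the same as
integrating the correlation of `G` and `p` over `[0, h]`. -/
theorem integral_pairing_increment (B : E →L[ℝ] F →L[ℝ] ℝ) {G : ℝ → E} {p : ℝ → F}
    (hG : MemLp G 2) (hp : MemLp p 2) {h : ℝ} (hh : 0 ≤ h) :
    ∫ t, B (∫ r in (t - h)..t, G r) (p t) = ∫ s in (0 : ℝ)..h, ∫ t, B (G (t - s)) (p t) := by
  simp_rw [pairing_increment_eq_integral B hG hh]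
  rw [intervalIntegral.integral_of_le hh]
  exact integral_integral_swap (integrable_prod_translate_pairing B hG hp h)

/-- Steklov averages of a square integrable function converge weakly in `L²`. -/
theorem tendsto_integral_pairing_steklov (B : E →L[ℝ] F →L[ℝ] ℝ) {G : ℝ → E} {p : ℝ → F}
    (hG : MemLp G 2) (hp : MemLp p 2) :
    Tendsto (fun h : ℝ => h⁻¹ * ∫ t, B (∫ r in (t - h)..t, G r) (p t)) (𝓝[>] 0)
      (𝓝 (∫ t, B (G t) (p t))) := by
  have hc := continuous_integral_translate_pairing B hG hp
  have hd := (hc.integral_hasStrictDerivAt 0 0).hasDerivAt.tendsto_slope_zero_right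
  simp only [zero_add, sub_zero, intervalIntegral.integral_same, smul_eq_mul] at hd
  refine hd.congr' ?_
  filter_upwards [self_mem_nhdsWithin] with h hh
  rw [integral_pairing_increment B hG hp (le_of_lt hh)]

end Steklov

/-! ### The duality pairing -/

section Pairing

variable {𝕜 V H : Type*} [RCLike 𝕜] [NormedAddCommGroup V] [InnerProductSpace 𝕜 V]
  [NormedSpace ℝ V] [IsScalarTower ℝ 𝕜 V] [NormedAddCommGroup H] [InnerProductSpace 𝕜 H]

variable (𝕜 V) in
/-- The real part of the duality pairing between `V'` and `V`, as a bounded real bilinear map. -/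
noncomputable def antidualRePairing : Antidual 𝕜 V →L[ℝ] V →L[ℝ] ℝ :=
  (LinearMap.mk₂ ℝ (fun (f : Antidual 𝕜 V) (v : V) => RCLike.re (f v))
    (fun f g v => by simp) (fun c f v => by simp [RCLike.smul_re])
    (fun f v w => by simp)
    (fun c f v => by
      rw [← algebraMap_smul 𝕜 c v, map_smulₛₗ]
      simp)).mkContinuous₂ 1 fun f v => by
    simpa using (RCLike.norm_re_le_norm (f v)).trans (f.le_opNorm v)

@[simp]
theorem antidualRePairing_apply (f : Antidual 𝕜 V) (v : V) :
    antidualRePairing 𝕜 V f v = RCLike.re (f v) := rfl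

/-- One-sided substitute for the product rule for `‖·‖²`. -/
theorem norm_sq_sub_norm_sq_le_re_inner (x y : H) :
    ‖x‖ ^ 2 - ‖y‖ ^ 2 ≤ 2 * (RCLike.re (inner 𝕜 x x) - RCLike.re (inner 𝕜 x y)) := by
  have h := @norm_sub_sq 𝕜 _ _ _ _ x y
  rw [inner_self_eq_norm_sq]
  nlinarith [sq_nonneg ‖x - y‖]

omit [NormedSpace ℝ V] [IsScalarTower ℝ 𝕜 V] in
theorem toAntidual_re_sub (j : V →L[𝕜] H) (x y : H) (v : V) :
    RCLike.re ((toAntidual j x - toAntidual j y) v) =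
      RCLike.re (inner 𝕜 (j v) x) - RCLike.re (inner 𝕜 (j v) y) := by
  simp [toAntidual_apply]

end Pairing

/-! ### The energy inequality -/

/-- Summation by parts for a weight decreasing at the constant rate `2 * lam`: shifting by `h`
costs at most `h` times the past value `c`, and gains `2 * lam * h` times the integral. -/
theorem integral_weight_mul_sub_shift_ge {T lam h c : ℝ} (hlam : 0 ≤ lam)
    (hlT : 4 * lam * T ≤ 1) (hh : 0 < h) (hhT : h ≤ T) {φ : ℝ → ℝ} (hφ0 : ∀ t, 0 ≤ φ t)
    (hc : ∀ t ≤ 0, φ t = c) (hφ : IntegrableOn φ (Ioc 0 T)) :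
    IntervalIntegrable (fun t => (1 - 2 * lam * t) * (φ t - φ (t - h))) volume 0 T ∧
    2 * lam * h * (∫ t in (0 : ℝ)..T, φ t) - h * c ≤
      ∫ t in (0 : ℝ)..T, (1 - 2 * lam * t) * (φ t - φ (t - h)) := by
  have hT : 0 ≤ T := hh.le.trans hhT
  have hc0 : 0 ≤ c := hc 0 le_rfl ▸ hφ0 0
  have hφT : IntervalIntegrable φ volume 0 T := by
    rwa [intervalIntegrable_iff_integrableOn_Ioc_of_le hT]
  have hφh : IntervalIntegrable φ volume (-h) 0 := by
    refine IntervalIntegrable.congr (f := fun _ => c) (fun t ht => ?_) intervalIntegrable_const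
    rw [uIoc_of_le (by linarith)] at ht
    exact (hc t ht.2).symm
  have hall : IntervalIntegrable φ volume (-h) T := hφh.trans hφT
  have hφs : IntervalIntegrable φ volume (-h) (T - h) :=
    hall.mono_set (by
      rw [uIcc_of_le (by linarith), uIcc_of_le (by linarith)]
      exact Icc_subset_Icc le_rfl (by linarith))
  have hφsT : IntervalIntegrable φ volume 0 (T - h) :=
    hφT.mono_set (by
      rw [uIcc_of_le (by linarith), uIcc_of_le (by linarith)]
      exact Icc_subset_Icc le_rfl (by linarith))
  have hsh : IntervalIntegrable (fun t => φ (t - h)) volume 0 T := by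
    simpa using hφs.comp_sub_right h
  have hi1 : IntervalIntegrable (fun t => (1 - 2 * lam * t) * φ t) volume 0 T :=
    hφT.continuousOn_mul (by fun_prop)
  have hi2 : IntervalIntegrable (fun t => (1 - 2 * lam * t) * φ (t - h)) volume 0 T :=
    hsh.continuousOn_mul (by fun_prop)
  have hi3 : IntervalIntegrable (fun t => (1 - 2 * lam * (t + h)) * φ t) volume (-h) 0 :=
    hφh.continuousOn_mul (by fun_prop)
  have hi4 : IntervalIntegrable (fun t => (1 - 2 * lam * (t + h)) * φ t) volume 0 T :=
    hφT.continuousOn_mul (by fun_prop)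
  have hi5 : IntervalIntegrable (fun t => (1 - 2 * lam * (t + h)) * φ t) volume 0 (T - h) :=
    hφsT.continuousOn_mul (by fun_prop)
  have hexp : ∀ t, (1 - 2 * lam * t) * (φ t - φ (t - h)) =
      (1 - 2 * lam * t) * φ t - (1 - 2 * lam * t) * φ (t - h) := fun t => by ring
  simp_rw [hexp]
  refine ⟨hi1.sub hi2, ?_⟩
  rw [intervalIntegral.integral_sub hi1 hi2]
  have e1 : ∫ t in (0 : ℝ)..T, (1 - 2 * lam * t) * φ (t - h) =
      (∫ t in (-h)..0, (1 - 2 * lam * (t + h)) * φ t) +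
        ∫ t in (0 : ℝ)..(T - h), (1 - 2 * lam * (t + h)) * φ t := by
    rw [intervalIntegral.integral_add_adjacent_intervals hi3 hi5]
    have := intervalIntegral.integral_comp_sub_right (a := 0) (b := T)
      (fun t => (1 - 2 * lam * (t + h)) * φ t) h
    simpa using this
  have e2 : ∫ t in (-h)..0, (1 - 2 * lam * (t + h)) * φ t ≤ h * c := by
    have : ∫ t in (-h)..0, (1 - 2 * lam * (t + h)) * φ t ≤ ∫ _t in (-h)..0, c := by
      refine intervalIntegral.integral_mono_on (by linarith) hi3 intervalIntegrable_const
        fun t ht => ?_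
      rw [hc t ht.2]
      nlinarith [mul_nonneg (mul_nonneg hlam (by linarith [ht.1] : 0 ≤ t + h)) hc0]
    simpa using this
  have e3 : ∫ t in (0 : ℝ)..(T - h), (1 - 2 * lam * (t + h)) * φ t ≤
      ∫ t in (0 : ℝ)..T, (1 - 2 * lam * (t + h)) * φ t := by
    refine intervalIntegral.integral_mono_interval le_rfl (by linarith) (by linarith) ?_ hi4
    refine (ae_restrict_iff' measurableSet_Ioc).2 (Eventually.of_forall fun t ht => ?_)
    refine mul_nonneg ?_ (hφ0 t)
    -- `4 * lam * T ≤ 1` keeps the weight nonnegative up to `2 * T`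
    nlinarith [mul_le_mul_of_nonneg_left (by linarith [ht.2] : t + h ≤ 2 * T) hlam]
  have e4 : ∫ t in (0 : ℝ)..T, (1 - 2 * lam * (t + h)) * φ t =
      (∫ t in (0 : ℝ)..T, (1 - 2 * lam * t) * φ t) -
        2 * lam * h * ∫ t in (0 : ℝ)..T, φ t := by
    rw [← intervalIntegral.integral_const_mul, ← intervalIntegral.integral_sub hi1
      (hφT.const_mul _)]
    congr 1
    ext t
    ring
  linarith

theorem MeasureTheory.MemLp.smul_of_ae_abs_le_one {X F : Type*} [MeasurableSpace X]
    {μ : Measure X} [NormedAddCommGroup F] [NormedSpace ℝ F] {q : ENNReal} {w : X → F} {ρ : X → ℝ}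
    (hw : MemLp w q μ) (hρ : AEStronglyMeasurable ρ μ) (hb : ∀ᵐ t ∂μ, |ρ t| ≤ 1) :
    MemLp (fun t => ρ t • w t) q μ := by
  refine hw.of_le (hρ.smul hw.1) ?_
  filter_upwards [hb] with t ht
  rw [norm_smul]
  exact mul_le_of_le_one_left (norm_nonneg _) ht

/-- Weighted energy inequality. Let `w` have the weak derivative `g` and the initial value `x` when
read in `E` through `D`, where `B` is the duality between `E` and the values of `w`, and `y` is `w`
read in the Hilbert space `H`. Integrating `d/dt ‖y‖² = 2 ⟨g, w⟩` against the weight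
`1 - 2 * lam * t` produces the term `lam * ∫ ‖y‖²`. -/
theorem weighted_energy_inequality {𝕜 E F H : Type*} [RCLike 𝕜] [NormedAddCommGroup E]
    [NormedSpace ℝ E] [CompleteSpace E] [NormedAddCommGroup F] [NormedSpace ℝ F]
    [NormedAddCommGroup H] [InnerProductSpace 𝕜 H] {T lam : ℝ} (hT : 0 < T) (hlam : 0 ≤ lam)
    (hlT : 4 * lam * T ≤ 1) (B : E →L[ℝ] F →L[ℝ] ℝ) (D : H → E) {w : ℝ → F} {y : ℝ → H} {g : ℝ → E}
    {x : H} (hw : MemLp w 2 (timeMeasure T)) (hy : MemLp y 2 (timeMeasure T))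
    (hg : MemLp g 2 (timeMeasure T))
    (hBD : ∀ t h h', B (D h - D h') (w t) =
      RCLike.re (inner 𝕜 (y t) h) - RCLike.re (inner 𝕜 (y t) h'))
    (hW : ∀ᵐ t ∂timeMeasure T, D (y t) = D x + ∫ s in (0 : ℝ)..t, g s) :
    lam * ∫ t in Ioo 0 T, ‖y t‖ ^ 2 ≤
      ‖x‖ ^ 2 / 2 + ∫ t in Ioo 0 T, (1 - 2 * lam * t) * B (g t) (w t) := by
  -- extension to the whole line: `g` and the test function vanish outside `(0, T)`
  set G : ℝ → E := (Ioo 0 T).indicator g with hGdef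
  set p : ℝ → F := (Ioo 0 T).indicator fun t => (1 - 2 * lam * t) • w t with hpdef
  have hG : MemLp G 2 := (memLp_indicator_iff_restrict measurableSet_Ioo).2 hg
  have hp : MemLp p 2 := by
    refine (memLp_indicator_iff_restrict measurableSet_Ioo).2 (hw.smul_of_ae_abs_le_one ?_ ?_)
    · fun_prop
    refine (ae_restrict_iff' measurableSet_Ioo).2 (Eventually.of_forall fun t ht => ?_)
    have h1 := mul_nonneg hlam ht.1.le
    have h2 := mul_le_mul_of_nonneg_left ht.2.le hlam
    exact abs_le.2 ⟨by linarith, by linarith⟩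
  have hGl : LocallyIntegrable G := hG.locallyIntegrable (by norm_num)
  have hGI : ∀ a b : ℝ, IntervalIntegrable G volume a b := fun a b =>
    (hGl.integrableOn_isCompact isCompact_uIcc).intervalIntegrable
  -- the past values of `w` are the constant `x`
  set k : ℝ → H := fun t => if 0 < t then y t else x with hkdef
  have hk : ∀ᵐ t : ℝ, t < T → D (k t) = D x + ∫ s in (0 : ℝ)..t, G s := by
    filter_upwards [(ae_restrict_iff' measurableSet_Ioo).1 hW] with t ht htT
    by_cases h0 : 0 < t
    · simp only [hkdef, if_pos h0]
      rw [ht ⟨h0, htT⟩]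
      congr 1
      refine intervalIntegral.integral_congr_ae (Eventually.of_forall fun s hs => ?_)
      rw [uIoc_of_le h0.le] at hs
      rw [hGdef, indicator_of_mem (show s ∈ Ioo 0 T from ⟨hs.1, hs.2.trans_lt htT⟩)]
    · simp only [hkdef, if_neg h0]
      rw [intervalIntegral.integral_zero_ae, add_zero]
      refine Eventually.of_forall fun s hs => ?_
      rw [uIoc_of_ge (not_lt.1 h0)] at hs
      rw [hGdef, indicator_of_notMem fun h' : s ∈ Ioo 0 T => not_lt.2 hs.2 h'.1]
  have hφi : IntegrableOn (fun t => ‖k t‖ ^ 2) (Ioc 0 T) := by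
    rw [integrableOn_Ioc_iff_integrableOn_Ioo]
    have := hy.integrable_norm_pow (by norm_num)
    refine this.congr ((ae_restrict_iff' measurableSet_Ioo).2
      (Eventually.of_forall fun t ht => ?_))
    simp [hkdef, ht.1]
  have hφk : ∫ t in (0 : ℝ)..T, ‖k t‖ ^ 2 = ∫ t in Ioo 0 T, ‖y t‖ ^ 2 := by
    rw [intervalIntegral.integral_of_le hT.le, integral_Ioc_eq_integral_Ioo]
    refine setIntegral_congr_fun measurableSet_Ioo fun t ht => ?_
    simp [hkdef, ht.1]
  have hlim := tendsto_integral_pairing_steklov B hG hp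
  have hval : ∫ t, B (G t) (p t) = ∫ t in Ioo 0 T, (1 - 2 * lam * t) * B (g t) (w t) := by
    rw [← integral_indicator measurableSet_Ioo]
    refine integral_congr_ae (Eventually.of_forall fun t => ?_)
    by_cases ht : t ∈ Ioo 0 T
    · simp [hGdef, hpdef, ht]
    · simp [hGdef, hpdef, ht]
  rw [hval] at hlim
  rw [← hφk, ← sub_le_iff_le_add']
  refine ge_of_tendsto hlim ?_
  filter_upwards [Ioo_mem_nhdsGT hT] with h hh
  obtain ⟨hLi, hL⟩ := integral_weight_mul_sub_shift_ge hlam hlT hh.1 hh.2.le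
    (φ := fun t => ‖k t‖ ^ 2) (c := ‖x‖ ^ 2) (fun t => by positivity)
    (fun t ht => by simp [hkdef, not_lt.2 ht]) hφi
  have hk' : ∀ᵐ t : ℝ, t - h < T →
      D (k (t - h)) = D x + ∫ s in (0 : ℝ)..(t - h), G s :=
    (measurePreserving_sub_right volume h).quasiMeasurePreserving.ae hk
  have hint := integrable_pairing_increment B hG hp hh.1.le
  have hcmp : ∫ t in (0 : ℝ)..T, (1 - 2 * lam * t) * (‖k t‖ ^ 2 - ‖k (t - h)‖ ^ 2) ≤
      ∫ t in (0 : ℝ)..T, 2 * B (∫ r in (t - h)..t, G r) (p t) := by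
    refine intervalIntegral.integral_mono_ae_restrict hT.le hLi
      ((hint.const_mul 2).intervalIntegrable) ?_
    rw [← restrict_Ioo_eq_restrict_Icc]
    refine (ae_restrict_iff' measurableSet_Ioo).2 ?_
    filter_upwards [hk, hk'] with t h1 h2 ht
    have hinc : ∫ r in (t - h)..t, G r = D (k t) - D (k (t - h)) := by
      rw [h1 ht.2, h2 (by linarith [ht.2, hh.1]), add_sub_add_left_eq_sub,
        intervalIntegral.integral_interval_sub_left (hGI _ _) (hGI _ _)]
    have hkt : y t = k t := by simp [hkdef, ht.1]
    have hρ : 0 ≤ 1 - 2 * lam * t := by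
      nlinarith [mul_le_mul_of_nonneg_left ht.2.le hlam]
    have hB : B (∫ r in (t - h)..t, G r) (p t) = (1 - 2 * lam * t) *
        (RCLike.re (inner 𝕜 (k t) (k t)) - RCLike.re (inner 𝕜 (k t) (k (t - h)))) := by
      rw [hinc, hpdef, indicator_of_mem ht, map_smul, smul_eq_mul, hBD, hkt]
    change _ ≤ 2 * B (∫ r in (t - h)..t, G r) (p t)
    rw [hB]
    have := mul_le_mul_of_nonneg_left (norm_sq_sub_norm_sq_le_re_inner (𝕜 := 𝕜) (k t) (k (t - h)))
      hρ
    linarith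
  have hset : ∫ t in (0 : ℝ)..T, B (∫ r in (t - h)..t, G r) (p t) =
      ∫ t, B (∫ r in (t - h)..t, G r) (p t) := by
    rw [intervalIntegral.integral_of_le hT.le, integral_Ioc_eq_integral_Ioo]
    refine setIntegral_eq_integral_of_forall_compl_eq_zero fun t ht => ?_
    rw [hpdef, indicator_of_notMem ht, map_zero]
  rw [intervalIntegral.integral_const_mul, hset] at hcmp
  rw [← mul_le_mul_iff_right₀ hh.1, mul_inv_cancel_left₀ hh.1.ne']
  linarith

/-! ### Norms and the velocity estimate -/

section L2Norm

variable {E F : Type*} [NormedAddCommGroup E] [NormedAddCommGroup F] {T : ℝ}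

theorem l2Norm_nonneg (g : ℝ → E) : 0 ≤ l2Norm T g := ENNReal.toReal_nonneg

theorem l2Norm_eq_rpow {g : ℝ → E} (hg : MemLp g 2 (timeMeasure T)) :
    l2Norm T g = (∫ t in Ioo 0 T, ‖g t‖ ^ (2 : ℝ)) ^ (1 / 2 : ℝ) := by
  rw [l2Norm, hg.eLpNorm_eq_integral_rpow_norm (by norm_num) (by norm_num), ENNReal.toReal_ofReal]
  · norm_num
  · positivity

theorem l2Norm_sq {g : ℝ → E} (hg : MemLp g 2 (timeMeasure T)) :
    l2Norm T g ^ 2 = ∫ t in Ioo 0 T, ‖g t‖ ^ 2 := by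
  have h0 : 0 ≤ ∫ t in Ioo 0 T, ‖g t‖ ^ (2 : ℝ) := by positivity
  rw [l2Norm_eq_rpow hg, ← Real.sqrt_eq_rpow, Real.sq_sqrt h0]
  simp

theorem integral_norm_mul_norm_le_l2Norm {g : ℝ → E} {w : ℝ → F}
    (hg : MemLp g 2 (timeMeasure T)) (hw : MemLp w 2 (timeMeasure T)) :
    ∫ t in Ioo 0 T, ‖g t‖ * ‖w t‖ ≤ l2Norm T g * l2Norm T w := by
  have h := integral_mul_norm_le_Lp_mul_Lq (μ := timeMeasure T) (f := fun t => ‖g t‖)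
    (g := fun t => ‖w t‖) (p := 2) (q := 2) Real.HolderConjugate.two_two
    (by simpa using hg.norm) (by simpa using hw.norm)
  rw [l2Norm_eq_rpow hg, l2Norm_eq_rpow hw]
  simpa only [norm_norm] using h

theorem l2Norm_le_of_ae_bound {g : ℝ → E} (hT : 0 ≤ T) {c : ℝ} (hc : 0 ≤ c)
    (h : ∀ᵐ t ∂timeMeasure T, ‖g t‖ ≤ c) : l2Norm T g ≤ √T * c := by
  have h1 := eLpNorm_le_of_ae_bound (p := 2) h
  refine (ENNReal.toReal_mono ?_ h1).trans ?_
  · simp [ENNReal.mul_eq_top]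
  · simp [ENNReal.toReal_mul, ENNReal.toReal_ofReal hc, ENNReal.toReal_ofReal hT,
      ← ENNReal.toReal_rpow, Real.sqrt_eq_rpow]

theorem l2Norm_le_mul {g : ℝ → E} {w : ℝ → F} (hw : MemLp w 2 (timeMeasure T)) {c : ℝ}
    (hc : 0 ≤ c) (h : ∀ᵐ t ∂timeMeasure T, ‖g t‖ ≤ c * ‖w t‖) : l2Norm T g ≤ c * l2Norm T w := by
  have h1 := eLpNorm_le_mul_eLpNorm_of_ae_le_mul h 2
  refine (ENNReal.toReal_mono (ENNReal.mul_ne_top (by simp) hw.eLpNorm_ne_top) h1).trans ?_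
  rw [ENNReal.toReal_mul, ENNReal.toReal_ofReal hc, l2Norm]

theorem l2Norm_le_add {E' : Type*} [NormedAddCommGroup E'] {g : ℝ → E} {w : ℝ → F} {v : ℝ → E'}
    (hw : MemLp w 2 (timeMeasure T)) (hv : MemLp v 2 (timeMeasure T))
    (h : ∀ᵐ t ∂timeMeasure T, ‖g t‖ ≤ ‖w t‖ + ‖v t‖) : l2Norm T g ≤ l2Norm T w + l2Norm T v := by
  have h1 := (eLpNorm_mono_ae_real h).trans
    (eLpNorm_add_le hw.norm.1 hv.norm.1 (p := 2) (by norm_num))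
  rw [eLpNorm_norm, eLpNorm_norm] at h1
  refine (ENNReal.toReal_mono (ENNReal.add_ne_top.2 ⟨hw.eLpNorm_ne_top, hv.eLpNorm_ne_top⟩)
    h1).trans ?_
  rw [ENNReal.toReal_add hw.eLpNorm_ne_top hv.eLpNorm_ne_top, l2Norm, l2Norm]

/-- Displacement is controlled by the initial displacement and the velocity. -/
theorem l2Norm_le_initialValue_add_l2Norm [NormedSpace ℝ E] (hT : 0 < T) {u w : ℝ → E} {u₀ : E}
    (hw : MemLp w 2 (timeMeasure T))
    (hu : ∀ᵐ t ∂timeMeasure T, u t = u₀ + ∫ s in (0 : ℝ)..t, w s) :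
    l2Norm T u ≤ √T * (‖u₀‖ + √T * l2Norm T w) := by
  have hwi : IntegrableOn w (Ioo 0 T) := hw.integrable (by norm_num)
  have h1 : ∫ t in Ioo 0 T, ‖w t‖ ≤ √T * l2Norm T w := by
    have h2 := integral_norm_mul_norm_le_l2Norm (memLp_const (1 : ℝ)) hw
    have h3 : l2Norm T (fun _ : ℝ => (1 : ℝ)) ≤ √T * 1 :=
      l2Norm_le_of_ae_bound hT.le zero_le_one (Eventually.of_forall fun t => by simp)
    simp only [norm_one, one_mul, mul_one] at h2 h3
    exact h2.trans (mul_le_mul_of_nonneg_right h3 (l2Norm_nonneg w))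
  refine l2Norm_le_of_ae_bound hT.le (by have := l2Norm_nonneg (T := T) w; positivity) ?_
  filter_upwards [hu, ae_restrict_mem measurableSet_Ioo] with t ht htT
  rw [ht]
  refine (norm_add_le _ _).trans (add_le_add_right (le_trans ?_ h1) _)
  refine (intervalIntegral.norm_integral_le_integral_norm htT.1.le).trans ?_
  rw [intervalIntegral.integral_of_le htT.1.le]
  refine setIntegral_mono_set hwi.norm (Eventually.of_forall fun _ => norm_nonneg _)
    (Eventually.of_forall fun s hs => ⟨hs.1, lt_of_le_of_lt hs.2 htT.2⟩)

end L2Norm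

/-- A quadratic inequality with lower order term bounds its solution linearly in the data. -/
theorem le_mul_of_sq_le {α K N D : ℝ} (hα : 0 < α) (hK : 0 ≤ K) (hD : 0 ≤ D)
    (h : α * N ^ 2 ≤ D ^ 2 / 2 + K * D * N) : N ≤ (1 + (K + 1) / α) * D := by
  by_contra! hlt
  have hC : 0 ≤ (K + 1) / α := by positivity
  have hDN : D < N := by nlinarith [mul_nonneg hC hD]
  have hN : 0 < N := hD.trans_lt hDN
  have h1 : α * ((1 + (K + 1) / α) * D) * N < α * N * N := by gcongr
  have h2 : α * ((1 + (K + 1) / α) * D) * N = α * D * N + (K + 1) * D * N := by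
    field_simp
  nlinarith [mul_le_mul_of_nonneg_left hDN.le hD, mul_nonneg (mul_nonneg hα.le hD) hN.le,
    mul_nonneg hD hN.le]

/-- The velocity estimate. The energy inequality with weight between `1/2` and `1` absorbs the
quasi-coercivity defect `ω ‖y‖²`; for `M * T ≤ α / 4` coercivity absorbs the contribution of the
velocity to the displacement `u`. -/
theorem velocity_estimate {𝕜 E F H : Type*} [RCLike 𝕜] [NormedAddCommGroup E]
    [NormedSpace ℝ E] [CompleteSpace E] [NormedAddCommGroup F] [NormedSpace ℝ F]
    [NormedAddCommGroup H] [InnerProductSpace 𝕜 H] {T ω α M : ℝ} (hT : 0 < T) (hα : 0 < α)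
    (hM : 0 ≤ M) (hωT : 4 * |ω| * T ≤ 1) (hMT : M * T ≤ α / 4)
    (B : E →L[ℝ] F →L[ℝ] ℝ) (D : H → E) {u w : ℝ → F} {y : ℝ → H} {f g : ℝ → E}
    {u₀ : F} {x : H} (hu : MemLp u 2 (timeMeasure T)) (hw : MemLp w 2 (timeMeasure T))
    (hy : MemLp y 2 (timeMeasure T)) (hf : MemLp f 2 (timeMeasure T))
    (hg : MemLp g 2 (timeMeasure T))
    (hBD : ∀ t h h', B (D h - D h') (w t) =
      RCLike.re (inner 𝕜 (y t) h) - RCLike.re (inner 𝕜 (y t) h'))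
    (hW : ∀ᵐ t ∂timeMeasure T, D (y t) = D x + ∫ s in (0 : ℝ)..t, g s)
    (hU : ∀ᵐ t ∂timeMeasure T, u t = u₀ + ∫ s in (0 : ℝ)..t, w s)
    (hB : ∀ᵐ t ∂timeMeasure T, B (g t) (w t) ≤
      ‖f t‖ * ‖w t‖ + M * (‖u t‖ * ‖w t‖) - α * ‖w t‖ ^ 2 + ω * ‖y t‖ ^ 2) :
    l2Norm T w ≤ (1 + (1 + M * √T + 1) / (α / 4)) * (‖u₀‖ + ‖x‖ + l2Norm T f) := by
  have henergy := weighted_energy_inequality hT (abs_nonneg ω) hωT B D hw hy hg hBD hW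
  have hw2 : Integrable (fun t => ‖w t‖ ^ 2) (timeMeasure T) :=
    hw.integrable_norm_pow (by norm_num)
  have hy2 : Integrable (fun t => ‖y t‖ ^ 2) (timeMeasure T) :=
    hy.integrable_norm_pow (by norm_num)
  have hfw : Integrable (fun t => ‖f t‖ * ‖w t‖) (timeMeasure T) := hf.norm.integrable_mul hw.norm
  have huw : Integrable (fun t => ‖u t‖ * ‖w t‖) (timeMeasure T) := hu.norm.integrable_mul hw.norm
  have hgw : Integrable (fun t => ‖g t‖ * ‖w t‖) (timeMeasure T) := hg.norm.integrable_mul hw.norm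
  have hρ : ∀ t ∈ Ioo 0 T, 1 / 2 ≤ 1 - 2 * |ω| * t ∧ 1 - 2 * |ω| * t ≤ 1 := fun t ht => by
    have h1 := mul_nonneg (abs_nonneg ω) ht.1.le
    have h2 := mul_le_mul_of_nonneg_left ht.2.le (abs_nonneg ω)
    constructor <;> linarith
  have hBi : Integrable (fun t => (1 - 2 * |ω| * t) * B (g t) (w t)) (timeMeasure T) := by
    refine Integrable.mono' (hgw.const_mul ‖B‖)
      (AEStronglyMeasurable.mul (by fun_prop) (B.aestronglyMeasurable_comp₂ hg.1 hw.1)) ?_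
    filter_upwards [ae_restrict_mem measurableSet_Ioo] with t ht
    rw [norm_mul, Real.norm_of_nonneg (by linarith [(hρ t ht).1])]
    refine (mul_le_of_le_one_left (norm_nonneg _) (hρ t ht).2).trans ?_
    rw [← mul_assoc]
    exact B.le_opNorm₂ _ _
  have hR : Integrable (fun t => ‖f t‖ * ‖w t‖ + M * (‖u t‖ * ‖w t‖) - α / 2 * ‖w t‖ ^ 2 +
      |ω| * ‖y t‖ ^ 2) (timeMeasure T) :=
    ((hfw.add (huw.const_mul M)).sub (hw2.const_mul _)).add (hy2.const_mul _)
  have hle : ∫ t in Ioo 0 T, (1 - 2 * |ω| * t) * B (g t) (w t) ≤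
      ∫ t in Ioo 0 T, (‖f t‖ * ‖w t‖ + M * (‖u t‖ * ‖w t‖) - α / 2 * ‖w t‖ ^ 2 +
        |ω| * ‖y t‖ ^ 2) := by
    refine integral_mono_ae hBi hR ?_
    filter_upwards [hB, ae_restrict_mem measurableSet_Ioo] with t h1 ht
    obtain ⟨hρ1, hρ2⟩ := hρ t ht
    have hρ0 : 0 ≤ 1 - 2 * |ω| * t := by linarith
    refine (mul_le_mul_of_nonneg_left h1 hρ0).trans ?_
    have e1 : (1 - 2 * |ω| * t) * (‖f t‖ * ‖w t‖ + M * (‖u t‖ * ‖w t‖)) ≤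
        ‖f t‖ * ‖w t‖ + M * (‖u t‖ * ‖w t‖) := mul_le_of_le_one_left (by positivity) hρ2
    have e2 : α / 2 * ‖w t‖ ^ 2 ≤ (1 - 2 * |ω| * t) * (α * ‖w t‖ ^ 2) := by
      have := mul_le_mul_of_nonneg_right hρ1 (by positivity : 0 ≤ α * ‖w t‖ ^ 2)
      linarith
    have e3 : (1 - 2 * |ω| * t) * (ω * ‖y t‖ ^ 2) ≤ |ω| * ‖y t‖ ^ 2 := by
      have h3 : ω * ‖y t‖ ^ 2 ≤ |ω| * ‖y t‖ ^ 2 := by gcongr; exact le_abs_self ω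
      exact (mul_le_mul_of_nonneg_left h3 hρ0).trans (mul_le_of_le_one_left (by positivity) hρ2)
    linarith
  have hsplit : ∫ t in Ioo 0 T, (‖f t‖ * ‖w t‖ + M * (‖u t‖ * ‖w t‖) - α / 2 * ‖w t‖ ^ 2 +
      |ω| * ‖y t‖ ^ 2) = (∫ t in Ioo 0 T, ‖f t‖ * ‖w t‖) +
        M * (∫ t in Ioo 0 T, ‖u t‖ * ‖w t‖) - α / 2 * (∫ t in Ioo 0 T, ‖w t‖ ^ 2) +
        |ω| * ∫ t in Ioo 0 T, ‖y t‖ ^ 2 := by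
    have i1 : Integrable (fun t => ‖f t‖ * ‖w t‖ + M * (‖u t‖ * ‖w t‖)) (timeMeasure T) :=
      hfw.add (huw.const_mul M)
    have i2 : Integrable (fun t => ‖f t‖ * ‖w t‖ + M * (‖u t‖ * ‖w t‖) - α / 2 * ‖w t‖ ^ 2)
        (timeMeasure T) := i1.sub (hw2.const_mul _)
    rw [integral_add i2 (hy2.const_mul _), integral_sub i1 (hw2.const_mul _),
      integral_add hfw (huw.const_mul M), integral_const_mul, integral_const_mul,
      integral_const_mul]
  rw [hsplit, ← l2Norm_sq hw] at hle
  have hcs1 := integral_norm_mul_norm_le_l2Norm hf hw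
  have hcs2 := integral_norm_mul_norm_le_l2Norm hu hw
  have hul := l2Norm_le_initialValue_add_l2Norm hT hw hU
  have hN := l2Norm_nonneg (T := T) w
  have hF := l2Norm_nonneg (T := T) f
  set N := l2Norm T w
  set Fn := l2Norm T f
  have hsT : √T * √T = T := Real.mul_self_sqrt hT.le
  have hs0 : 0 ≤ √T := Real.sqrt_nonneg T
  have hu1 : M * (∫ t in Ioo 0 T, ‖u t‖ * ‖w t‖) ≤ M * √T * ‖u₀‖ * N + α / 4 * N ^ 2 := by
    calc M * (∫ t in Ioo 0 T, ‖u t‖ * ‖w t‖) ≤ M * (√T * (‖u₀‖ + √T * N) * N) := by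
          gcongr
          exact hcs2.trans (by gcongr)
      _ = M * √T * ‖u₀‖ * N + M * (√T * √T) * N ^ 2 := by ring
      _ ≤ M * √T * ‖u₀‖ * N + α / 4 * N ^ 2 := by rw [hsT]; gcongr
  refine le_mul_of_sq_le (by positivity) (by positivity) (by positivity) ?_
  have hx : ‖x‖ ^ 2 ≤ (‖u₀‖ + ‖x‖ + Fn) ^ 2 := by
    gcongr
    linarith [norm_nonneg u₀]
  have hK : Fn * N + M * √T * ‖u₀‖ * N ≤ (1 + M * √T) * (‖u₀‖ + ‖x‖ + Fn) * N := by
    have h1 : 0 ≤ (‖u₀‖ + ‖x‖) * N := by positivity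
    have h2 : 0 ≤ M * √T * (‖x‖ + Fn) * N := by positivity
    linarith
  linarith

/-! ### Solutions of the second order problem -/

section Embedding

variable {𝕜 V H : Type*} [RCLike 𝕜] [NormedAddCommGroup V] [InnerProductSpace 𝕜 V]
  [NormedAddCommGroup H] [InnerProductSpace 𝕜 H]

theorem toAntidual_sub (j : V →L[𝕜] H) (x y : H) :
    toAntidual j (x - y) = toAntidual j x - toAntidual j y := by
  ext v
  simp [toAntidual_apply, inner_sub_right]

theorem norm_toAntidual_le (j : V →L[𝕜] H) (x : H) : ‖toAntidual j x‖ ≤ ‖j‖ * ‖x‖ := by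
  refine ContinuousLinearMap.opNorm_le_bound _ (by positivity) fun v => ?_
  rw [toAntidual_apply]
  calc ‖inner 𝕜 (j v) x‖ ≤ ‖j v‖ * ‖x‖ := norm_inner_le_norm _ _
    _ ≤ ‖j‖ * ‖v‖ * ‖x‖ := by gcongr; exact j.le_opNorm v
    _ = ‖j‖ * ‖x‖ * ‖v‖ := by ring

theorem norm_toAntidual_apply_le (j : V →L[𝕜] H) (v : V) :
    ‖toAntidual j (j v)‖ ≤ ‖j‖ ^ 2 * ‖v‖ := by
  calc ‖toAntidual j (j v)‖ ≤ ‖j‖ * (‖j‖ * ‖v‖) :=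
        (norm_toAntidual_le j _).trans (by gcongr; exact j.le_opNorm v)
    _ = ‖j‖ ^ 2 * ‖v‖ := by ring

theorem continuous_toAntidual (j : V →L[𝕜] H) : Continuous (toAntidual j) := by
  refine (LipschitzWith.of_dist_le_mul (K := ‖j‖₊) fun x y => ?_).continuous
  rw [dist_eq_norm, dist_eq_norm, ← toAntidual_sub]
  exact norm_toAntidual_le j _

theorem memLp_toAntidual (j : V →L[𝕜] H) {T : ℝ} {w : ℝ → V} (hw : MemLp w 2 (timeMeasure T)) :
    MemLp (fun t => toAntidual j (j (w t))) 2 (timeMeasure T) :=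
  hw.of_le_mul (((continuous_toAntidual j).comp j.continuous).comp_aestronglyMeasurable hw.1)
    (Eventually.of_forall fun t => norm_toAntidual_apply_le j (w t))

theorem IsBoundedForm.norm_apply_le {T M : ℝ} (hM : 0 ≤ M) {a : ℝ → V →L[𝕜] Antidual 𝕜 V}
    (ha : IsBoundedForm T M a) {t : ℝ} (ht : t ∈ Icc 0 T) (v : V) : ‖a t v‖ ≤ M * ‖v‖ :=
  ContinuousLinearMap.opNorm_le_bound _ (by positivity) fun x => ha.bound t ht v x

variable [CompleteSpace V] [NormedSpace ℝ V] [IsScalarTower ℝ 𝕜 V]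

/-- The a priori bounds of displacement, velocity and acceleration by the data. -/
theorem IsSolution.l2Norm_bounds {T ω α M : ℝ} (hT : 0 < T) (hα : 0 < α) (hM : 0 ≤ M)
    (hωT : 4 * |ω| * T ≤ 1) (hMT : M * T ≤ α / 4) {j : V →L[𝕜] H}
    {a b : ℝ → V →L[𝕜] Antidual 𝕜 V} (ha : IsBoundedForm T M a) (hb : IsBoundedForm T M b)
    (hbc : IsQuasiCoercive j T ω α b) {f : ℝ → Antidual 𝕜 V} (hf : MemLp f 2 (timeMeasure T))
    {u₀ : V} {u₁ : H} {u du : ℝ → V} {ddu : ℝ → Antidual 𝕜 V}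
    (hs : IsSolution j T a b f u₀ u₁ u du ddu) :
    l2Norm T du ≤ (1 + (1 + M * √T + 1) / (α / 4)) * (‖u₀‖ + ‖u₁‖ + l2Norm T f) ∧
    l2Norm T u ≤ √T * (‖u₀‖ + √T * l2Norm T du) ∧
    l2Norm T ddu ≤ l2Norm T f + (M * l2Norm T du + M * l2Norm T u) := by
  have hu := hs.mr.memLp_u
  have hw := hs.mr.memLp_du
  have hg := hs.mr.memLp_ddu
  have hU : ∀ᵐ t ∂timeMeasure T, u t = u₀ + ∫ s in (0 : ℝ)..t, du s :=
    hs.mr.deriv_u.ae_eq_initialValue_add_integral hT (hu.integrable (by norm_num))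
      (hw.integrable (by norm_num)) hs.initial_value
  have hW : ∀ᵐ t ∂timeMeasure T,
      toAntidual j (j (du t)) = toAntidual j u₁ + ∫ s in (0 : ℝ)..t, ddu s :=
    hs.mr.deriv_du.ae_eq_initialValue_add_integral hT
      ((memLp_toAntidual j hw).integrable (by norm_num)) (hg.integrable (by norm_num))
      hs.initial_velocity
  refine ⟨?_, l2Norm_le_initialValue_add_l2Norm hT hw hU, ?_⟩
  · refine velocity_estimate (𝕜 := 𝕜) (ω := ω) hT hα hM hωT hMT (antidualRePairing 𝕜 V)
      (toAntidual j) hu hw (j.comp_memLp' hw) hf hg (fun t h h' => ?_) hW hU ?_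
    · rw [antidualRePairing_apply, toAntidual_re_sub]
      rfl
    filter_upwards [hs.equation, ae_restrict_mem measurableSet_Ioo] with t ht htT
    have htI : t ∈ Icc 0 T := Ioo_subset_Icc_self htT
    have h1 : ddu t = f t - b t (du t) - a t (u t) := by
      rw [← ht]
      abel
    have h2 : RCLike.re (f t (du t)) ≤ ‖f t‖ * ‖du t‖ :=
      (RCLike.re_le_norm _).trans ((f t).le_opNorm _)
    have h3 : -RCLike.re (a t (u t) (du t)) ≤ M * (‖u t‖ * ‖du t‖) := by
      rw [← mul_assoc]
      exact (neg_le_abs _).trans ((RCLike.abs_re_le_norm _).trans (ha.bound t htI _ _))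
    have h4 := hbc t htI (du t)
    rw [antidualRePairing_apply, h1]
    simp only [sub_apply, map_sub, Function.comp_apply]
    linarith
  · have hr : MemLp (fun t => M * ‖du t‖ + M * ‖u t‖) 2 (timeMeasure T) :=
      (hw.norm.const_mul M).add (hu.norm.const_mul M)
    have h1 : l2Norm T ddu ≤ l2Norm T f + l2Norm T (fun t => M * ‖du t‖ + M * ‖u t‖) := by
      refine l2Norm_le_add hf hr ?_
      filter_upwards [hs.equation, ae_restrict_mem measurableSet_Ioo] with t ht htT
      have htI : t ∈ Icc 0 T := Ioo_subset_Icc_self htT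
      have h1 : ddu t = f t - (b t (du t) + a t (u t)) := by
        rw [← ht]
        abel
      rw [h1, Real.norm_of_nonneg (by positivity)]
      exact (norm_sub_le _ _).trans (add_le_add_right ((norm_add_le _ _).trans
        (add_le_add (hb.norm_apply_le hM htI _) (ha.norm_apply_le hM htI _))) _)
    have h2 : l2Norm T (fun t => M * ‖du t‖ + M * ‖u t‖) ≤
        l2Norm T (fun t => M * ‖du t‖) + l2Norm T (fun t => M * ‖u t‖) :=
      l2Norm_le_add (hw.norm.const_mul M) (hu.norm.const_mul M)
        (Eventually.of_forall fun t => norm_add_le _ _)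
    have h3 : l2Norm T (fun t => M * ‖du t‖) ≤ M * l2Norm T du :=
      l2Norm_le_mul hw hM (Eventually.of_forall fun t => by simp [abs_of_nonneg hM])
    have h4 : l2Norm T (fun t => M * ‖u t‖) ≤ M * l2Norm T u :=
      l2Norm_le_mul hu hM (Eventually.of_forall fun t => by simp [abs_of_nonneg hM])
    linarith

end Embedding

theorem mainTheorem2 (ω α M : ℝ) (hα : 0 < α) (hM : 0 ≤ M) :
    ∃ T₀ : ℝ, 0 < T₀ ∧ ∀ T : ℝ, 0 < T → T < T₀ →
      ∃ C : ℝ, 0 < C ∧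
        ∀ (𝕜 V H : Type*) [RCLike 𝕜]
          [NormedAddCommGroup V] [InnerProductSpace 𝕜 V] [CompleteSpace V]
          [TopologicalSpace.SeparableSpace V] [NormedSpace ℝ V] [IsScalarTower ℝ 𝕜 V]
          [NormedAddCommGroup H] [InnerProductSpace 𝕜 H] [CompleteSpace H]
          [TopologicalSpace.SeparableSpace H]
          (j : V →L[𝕜] H) (_ : Function.Injective j) (_ : DenseRange j)
          (a b : ℝ → V →L[𝕜] Antidual 𝕜 V)
          (_ : IsBoundedForm T M a) (_ : IsQuasiCoercive j T ω α a)
          (_ : IsBoundedForm T M b) (_ : IsQuasiCoercive j T ω α b)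
          (f : ℝ → Antidual 𝕜 V) (_ : MemLp f 2 (timeMeasure T)) (u₀ : V) (u₁ : H)
          (u du : ℝ → V) (ddu : ℝ → Antidual 𝕜 V)
          (_ : IsSolution j T a b f u₀ u₁ u du ddu),
          mrNorm T u du ddu ≤ C * (‖u₀‖ + ‖u₁‖ + l2Norm T f) ∧
          mrFullNorm j T u du ddu ≤ C * (1 + ‖j‖ ^ 2) * (‖u₀‖ + ‖u₁‖ + l2Norm T f) := by
  -- the first bound keeps the energy weight above `1 / 2`, the second absorbs the form `a`
  refine ⟨min (1 / (4 * (|ω| + 1))) (α / (4 * (M + 1))), by positivity, fun T hT hTT => ?_⟩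
  have hωT : 4 * |ω| * T ≤ 1 := by
    have h := (lt_div_iff₀ (by positivity)).1 (hTT.trans_le (min_le_left _ _))
    linarith
  have hMT : M * T ≤ α / 4 := by
    have h := (lt_div_iff₀ (by positivity)).1 (hTT.trans_le (min_le_right _ _))
    linarith
  -- the constants bounding velocity, displacement and acceleration in terms of the data
  obtain ⟨c₁, hc₁⟩ : ∃ c, c = 1 + (1 + M * √T + 1) / (α / 4) := ⟨_, rfl⟩
  obtain ⟨c₀, hc₀⟩ : ∃ c, c = √T * (1 + √T * c₁) := ⟨_, rfl⟩
  obtain ⟨c₂, hc₂⟩ : ∃ c, c = 1 + (M * c₁ + M * c₀) := ⟨_, rfl⟩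
  have hc₁0 : 0 < c₁ := by rw [hc₁]; positivity
  have hc₀0 : 0 < c₀ := by rw [hc₀]; positivity
  have hc₂0 : 0 < c₂ := by rw [hc₂]; positivity
  refine ⟨c₀ + c₁ + c₂, by positivity, ?_⟩
  intro 𝕜 V H _ _ _ _ _ _ _ _ _ _ _ j _ _ a b ha _ hb hbc f hf u₀ u₁ u du ddu hs
  obtain ⟨h1, h0, h2⟩ := hs.l2Norm_bounds hT hα hM hωT hMT ha hb hbc hf
  have hJu := l2Norm_le_mul hs.mr.memLp_u (sq_nonneg ‖j‖)
    (Eventually.of_forall fun t => norm_toAntidual_apply_le j (u t))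
  have hJdu := l2Norm_le_mul hs.mr.memLp_du (sq_nonneg ‖j‖)
    (Eventually.of_forall fun t => norm_toAntidual_apply_le j (du t))
  have hF := l2Norm_nonneg (T := T) f
  have hU0 := l2Norm_nonneg (T := T) u
  have hN0 := l2Norm_nonneg (T := T) du
  have hZ0 := l2Norm_nonneg (T := T) ddu
  have hJu0 := l2Norm_nonneg (T := T) fun t => toAntidual j (j (u t))
  have hJdu0 := l2Norm_nonneg (T := T) fun t => toAntidual j (j (du t))
  rw [← hc₁] at h1
  obtain ⟨D, hD⟩ : ∃ D, D = ‖u₀‖ + ‖u₁‖ + l2Norm T f := ⟨_, rfl⟩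
  have hD0 : 0 ≤ D := by rw [hD]; positivity
  rw [← hD] at h1
  have hu₀D : ‖u₀‖ ≤ D := by linarith [norm_nonneg u₁]
  have hFD : l2Norm T f ≤ D := by linarith [norm_nonneg u₀, norm_nonneg u₁]
  have h0' : l2Norm T u ≤ c₀ * D := by
    calc l2Norm T u ≤ √T * (D + √T * (c₁ * D)) := h0.trans (by gcongr)
      _ = c₀ * D := by rw [hc₀]; ring
  have h2' : l2Norm T ddu ≤ c₂ * D := by
    calc l2Norm T ddu ≤ D + (M * (c₁ * D) + M * (c₀ * D)) := h2.trans (by gcongr)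
      _ = c₂ * D := by rw [hc₂]; ring
  rw [← hD]
  constructor
  · refine Real.sqrt_le_iff.2 ⟨by positivity, ?_⟩
    calc l2Norm T u ^ 2 + l2Norm T du ^ 2 + l2Norm T ddu ^ 2
        ≤ (l2Norm T u + l2Norm T du + l2Norm T ddu) ^ 2 := by
          nlinarith [mul_nonneg hU0 hN0, mul_nonneg hU0 hZ0, mul_nonneg hN0 hZ0]
      _ ≤ ((c₀ + c₁ + c₂) * D) ^ 2 := by
          gcongr
          linarith
  · refine Real.sqrt_le_iff.2 ⟨by positivity, ?_⟩
    have hX : l2Norm T u + l2Norm T (fun t => toAntidual j (j (u t))) ≤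
        (1 + ‖j‖ ^ 2) * (c₀ * D) := by
      have := mul_le_mul_of_nonneg_left h0' (sq_nonneg ‖j‖)
      linarith
    have hY : l2Norm T du + l2Norm T (fun t => toAntidual j (j (du t))) ≤
        (1 + ‖j‖ ^ 2) * (c₁ * D) := by
      have := mul_le_mul_of_nonneg_left h1 (sq_nonneg ‖j‖)
      linarith
    have hZ : l2Norm T ddu ≤ (1 + ‖j‖ ^ 2) * (c₂ * D) := by
      have : 0 ≤ ‖j‖ ^ 2 * (c₂ * D) := by positivity
      linarith
    calc (l2Norm T u ^ 2 + l2Norm T du ^ 2) +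
          (l2Norm T (fun t => toAntidual j (j (u t))) ^ 2 +
            l2Norm T (fun t => toAntidual j (j (du t))) ^ 2 + l2Norm T ddu ^ 2)
        ≤ ((l2Norm T u + l2Norm T (fun t => toAntidual j (j (u t)))) +
            (l2Norm T du + l2Norm T (fun t => toAntidual j (j (du t)))) + l2Norm T ddu) ^ 2 := by
          have e1 := mul_nonneg hU0 hJu0
          have e2 := mul_nonneg hN0 hJdu0
          have e3 := mul_nonneg (add_nonneg hU0 hJu0) (add_nonneg hN0 hJdu0)
          have e4 := mul_nonneg (add_nonneg (add_nonneg hU0 hJu0) (add_nonneg hN0 hJdu0)) hZ0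
          linarith
      _ ≤ ((c₀ + c₁ + c₂) * (1 + ‖j‖ ^ 2) * D) ^ 2 := by
          gcongr
          linarith
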